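/- **Poincaré–Wirtinger inequality on hypersurfaces.** Let $N\ge 3$ and let $M\subset\mathbb{R}^N$ be a smooth, compact, connected (in particular non-empty) embedded hypersurface without boundary. Write $\mathcal H^{N-1}$ for the $(N-1)$-dimensional Hausdorff measure, let $L^1(M)=L^1(M,\mathcal H^{N-1})$, and let $W^{1,1}(M)$ be the space of real functions $u\in L^1(M)$ that have a weak tangential gradient $\nabla_M u\in L^1(M;\mathbb{R}^N)$; that is, $\nabla_M u$ is tangent to $M$ almost everywhere, and for every smooth local parametrization $\psi:V\to M$, $V\subset\mathbb{R}^{N-1}$ open, and every $v\in\mathbb{R}^{N-1}$, the weak derivative of $u\circ\psi$ on $V$ in the direction $v$ is $\langle(\nabla_M u)\circ\psi,\,D\psi\,v\rangle$. Then there exists a constant $C=C(N,M)>0$ such that for every $u\in W^{1,1}(M)$ $$\|u-u_M\|_{L^1(M)}\le C\,\|\nabla_M u\|_{L^1(M)},\qquad u_M:=\frac{1}{\mathcal H^{N-1}(M)}\int_M u\,d\mathcal H^{N-1}.$$ -/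

import Mathlib

open MeasureTheory Set
open scoped ContDiff

/-- A smooth local parametrization of the subset `M` of `ℝ^N` in `N - 1` variables: a smooth
immersion `ψ` on the open set `V ⊆ ℝ^(N-1)` that is a homeomorphism of `V` onto the relatively open
subset `M ∩ U` of `M`. -/
structure IsLocalParametrization {N : ℕ} (M : Set (EuclideanSpace ℝ (Fin N)))
    (V : Set (EuclideanSpace ℝ (Fin (N - 1)))) (U : Set (EuclideanSpace ℝ (Fin N)))
    (ψ : EuclideanSpace ℝ (Fin (N - 1)) → EuclideanSpace ℝ (Fin N)) : Prop where
  isOpen_domain : IsOpen V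
  isOpen_target : IsOpen U
  contDiffOn : ContDiffOn ℝ ∞ ψ V
  injective_fderiv : ∀ y ∈ V, Function.Injective (fderiv ℝ ψ y)
  image_eq : ψ '' V = M ∩ U
  exists_continuous_inverse : ∃ χ : EuclideanSpace ℝ (Fin N) → EuclideanSpace ℝ (Fin (N - 1)),
    ContinuousOn χ (M ∩ U) ∧ LeftInvOn χ ψ V

/-- `M ⊆ ℝ^N` is a smooth embedded hypersurface without boundary: every point of `M` lies in the
image of a smooth local parametrization of `M` by an open subset of `ℝ^(N-1)`. -/
def IsSmoothHypersurface {N : ℕ} (M : Set (EuclideanSpace ℝ (Fin N))) : Prop :=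
  ∀ p ∈ M, ∃ V U ψ, IsLocalParametrization M V U ψ ∧ p ∈ U

/-- `F` is the weak (distributional) derivative of `f` on the open set `V ⊆ ℝ^m`: both are locally
integrable on `V` and `∫ f ∂_v φ = - ∫ (F v) φ` for all test functions `φ` and directions `v`. -/
structure HasWeakFDerivOn {m : ℕ} (V : Set (EuclideanSpace ℝ (Fin m)))
    (f : EuclideanSpace ℝ (Fin m) → ℝ)
    (F : EuclideanSpace ℝ (Fin m) → (EuclideanSpace ℝ (Fin m) →L[ℝ] ℝ)) : Prop where
  locallyIntegrableOn : LocallyIntegrableOn f V volume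
  locallyIntegrableOn_deriv : LocallyIntegrableOn F V volume
  integral_eq : ∀ φ : EuclideanSpace ℝ (Fin m) → ℝ,
    ContDiff ℝ ∞ φ → HasCompactSupport φ → tsupport φ ⊆ V →
      ∀ v, ∫ y in V, f y * fderiv ℝ φ y v = - ∫ y in V, F y v * φ y

/-- `g` is the weak tangential gradient `∇_M u` of `u` on the hypersurface `M`. In every smooth
local parametrization `ψ`, the field `g` is almost everywhere tangent to `M` (it lies in the range
of `Dψ`), and the weak derivative of `u ∘ ψ` in the direction `v` is `⟨g ∘ ψ, Dψ v⟩`. Only the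
values of `u` and `g` on `M` matter. -/
structure HasWeakTangentialGradient {N : ℕ} (M : Set (EuclideanSpace ℝ (Fin N)))
    (u : EuclideanSpace ℝ (Fin N) → ℝ)
    (g : EuclideanSpace ℝ (Fin N) → EuclideanSpace ℝ (Fin N)) : Prop where
  tangent : ∀ V U ψ, IsLocalParametrization M V U ψ →
    ∀ᵐ y ∂(volume.restrict V), g (ψ y) ∈ Set.range (fderiv ℝ ψ y)
  weak_deriv : ∀ V U ψ, IsLocalParametrization M V U ψ →
    HasWeakFDerivOn V (fun y => u (ψ y))
      (fun y => (innerSL ℝ (g (ψ y))).comp (fderiv ℝ ψ y))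

/-- The surface measure on `M ⊆ ℝ^N`: the `(N-1)`-dimensional Hausdorff measure (normalized so as
to agree with Lebesgue measure on `ℝ^(N-1)`), restricted to `M`. -/
noncomputable def surfaceMeasure {N : ℕ} (M : Set (EuclideanSpace ℝ (Fin N))) :
    Measure (EuclideanSpace ℝ (Fin N)) :=
  (Measure.euclideanHausdorffMeasure (N - 1)).restrict M

/-- `u ∈ W^{1,1}(M)` with weak tangential gradient `∇_M u = g`: both `u` and `g` are in `L¹(M)`. -/
structure MemW11 {N : ℕ} (M : Set (EuclideanSpace ℝ (Fin N)))
    (u : EuclideanSpace ℝ (Fin N) → ℝ)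
    (g : EuclideanSpace ℝ (Fin N) → EuclideanSpace ℝ (Fin N)) : Prop where
  memLp : MemLp u 1 (surfaceMeasure M)
  memLp_gradient : MemLp g 1 (surfaceMeasure M)
  hasWeakTangentialGradient : HasWeakTangentialGradient M u g

/-! The quantity that is controlled is the double integral of |u(x) - u(y)| (`meanOscillation`)
rather than the deviation from a mean: it is monotone in the measure, transfers through charts, and
pieces can be glued without comparing their means.

On a ball, the increment of a C¹ function is the integral of its derivative along a segment;
averaging over all pairs of end points bounds the oscillation by the L¹ norm of the derivative
(`lintegral_lintegral_enorm_sub_le_of_contDiff`). Mollification and Fatou extend this to weak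
derivatives. Charts are locally bi-Lipschitz, so surface measure and Lebesgue measure are comparable
up to constants and no area formula is needed: every point of M has a neighbourhood that is a
Poincaré set (`IsSmoothHypersurface.exists_isPoincareSet`).

Two Poincaré sets whose intersection has positive measure can be glued (`IsPoincareSet.union`), and
nonempty relatively open sets have positive measure. Connectedness then joins any point to a base
point, and compactness makes M itself a Poincaré set. The deviation from the mean is at most the
oscillation divided by the area. -/

/-! ### Poincaré inequality for C¹ functions on convex sets -/

open Module in
/-- Change of variables under a homothety followed by a translation. -/
theorem lintegral_comp_add_smul {E : Type*} [NormedAddCommGroup E] [NormedSpace ℝ E]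
    [FiniteDimensional ℝ E] [MeasurableSpace E] [BorelSpace E] (μ : Measure E) [μ.IsAddHaarMeasure]
    {h : E → ENNReal} (hh : Measurable h) (a : E) {t : ℝ} (ht : t ≠ 0) :
    ∫⁻ x, h (a + t • x) ∂μ = ENNReal.ofReal |(t ^ finrank ℝ E)⁻¹| * ∫⁻ x, h x ∂μ := by
  have hm : Measurable fun x => h (a + x) := hh.comp (measurable_const_add a)
  rw [← lintegral_add_left_eq_self h a, ← smul_eq_mul, ← lintegral_smul_measure,
    ← Measure.map_addHaar_smul μ ht, lintegral_map hm (measurable_const_smul t)]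

/-- For fixed `t ∈ [1/2, 1]`, averaging over the points `y + t (x - y)` of a convex set. -/
theorem lintegral_lintegral_segment_le_of_half_le {E : Type*} [NormedAddCommGroup E]
    [NormedSpace ℝ E] [FiniteDimensional ℝ E] [MeasurableSpace E] [BorelSpace E] (μ : Measure E)
    [μ.IsAddHaarMeasure] {s : Set E} (hs : Convex ℝ s) (hsm : MeasurableSet s) {h : E → ENNReal}
    (hh : Measurable h) {t : ℝ} (ht : 1 / 2 ≤ t) (ht1 : t ≤ 1) :
    ∫⁻ y in s, ∫⁻ x in s, h (y + t • (x - y)) ∂μ ∂μ ≤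
      2 ^ Module.finrank ℝ E * μ s * ∫⁻ x in s, h x ∂μ := by
  have key : ∀ y ∈ s, ∫⁻ x in s, h (y + t • (x - y)) ∂μ ≤
      2 ^ Module.finrank ℝ E * ∫⁻ x in s, h x ∂μ := by
    intro y hy
    -- By convexity the segment stays in `s`, so `h` may be cut off outside `s`; the homothety of
    -- ratio `t` then costs t⁻ᵈ ≤ 2ᵈ.
    calc ∫⁻ x in s, h (y + t • (x - y)) ∂μ
        ≤ ∫⁻ x in s, s.indicator h ((y - t • y) + t • x) ∂μ := by
          refine setLIntegral_mono' hsm fun x hx => ?_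
          have e : (y - t • y) + t • x = y + t • (x - y) := by rw [smul_sub]; abel
          rw [e, indicator_of_mem (hs.add_smul_sub_mem hy hx ⟨by linarith, ht1⟩)]
      _ ≤ ∫⁻ x, s.indicator h ((y - t • y) + t • x) ∂μ := setLIntegral_le_lintegral _ _
      _ = ENNReal.ofReal |(t ^ Module.finrank ℝ E)⁻¹| * ∫⁻ x in s, h x ∂μ := by
          rw [lintegral_comp_add_smul μ (hh.indicator hsm) _ (by linarith), lintegral_indicator hsm]
      _ ≤ 2 ^ Module.finrank ℝ E * ∫⁻ x in s, h x ∂μ := by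
          gcongr
          have h0 : 0 < t := by linarith
          rw [abs_of_nonneg (by positivity), ← inv_pow, ENNReal.ofReal_pow (by positivity)]
          gcongr
          rw [← ENNReal.ofReal_ofNat]
          apply ENNReal.ofReal_le_ofReal
          rw [inv_le_comm₀ h0 (by norm_num)]
          linarith
  calc _ ≤ ∫⁻ y in s, 2 ^ Module.finrank ℝ E * ∫⁻ x in s, h x ∂μ ∂μ := setLIntegral_mono' hsm key
    _ = _ := by rw [setLIntegral_const]; ring

/-- For fixed `t ∈ [0, 1]`, averaging over the points `y + t (x - y)` of a convex set. -/
theorem lintegral_lintegral_segment_le {E : Type*} [NormedAddCommGroup E]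
    [NormedSpace ℝ E] [FiniteDimensional ℝ E] [MeasurableSpace E] [BorelSpace E] (μ : Measure E)
    [μ.IsAddHaarMeasure] {s : Set E} (hs : Convex ℝ s) (hsm : MeasurableSet s) {h : E → ENNReal}
    (hh : Measurable h) {t : ℝ} (ht : 0 ≤ t) (ht1 : t ≤ 1) :
    ∫⁻ y in s, ∫⁻ x in s, h (y + t • (x - y)) ∂μ ∂μ ≤
      2 ^ Module.finrank ℝ E * μ s * ∫⁻ x in s, h x ∂μ := by
  -- For small `t` the factor t⁻ᵈ blows up; exchanging `x` and `y` replaces `t` by `1 - t ≥ 1/2`.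
  rcases le_total (1 / 2) t with h2 | h2
  · exact lintegral_lintegral_segment_le_of_half_le μ hs hsm hh h2 ht1
  · rw [lintegral_lintegral_swap (by
      refine (hh.comp ?_).aemeasurable
      exact Continuous.measurable (by fun_prop))]
    have e : ∀ x y : E, y + t • (x - y) = x + (1 - t) • (y - x) := fun x y => by module
    simp only [e]
    exact lintegral_lintegral_segment_le_of_half_le μ hs hsm hh (by linarith) (by linarith)

/-- Averaging a continuous function over all segments with end points in a convex set. -/
theorem lintegral_lintegral_lintegral_segment_le {E : Type*} [NormedAddCommGroup E]
    [NormedSpace ℝ E] [FiniteDimensional ℝ E] [MeasurableSpace E] [BorelSpace E] (μ : Measure E)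
    [μ.IsAddHaarMeasure] {s : Set E} (hs : Convex ℝ s) (hsm : MeasurableSet s) {h : E → ENNReal}
    (hh : Continuous h) :
    ∫⁻ y in s, ∫⁻ x in s, (∫⁻ t in Ioc (0 : ℝ) 1, h (y + t • (x - y))) ∂μ ∂μ ≤
      2 ^ Module.finrank ℝ E * μ s * ∫⁻ x in s, h x ∂μ := by
  have hin : ∀ y, ∫⁻ x in s, (∫⁻ t in Ioc (0 : ℝ) 1, h (y + t • (x - y))) ∂μ =
      ∫⁻ t in Ioc (0 : ℝ) 1, ∫⁻ x in s, h (y + t • (x - y)) ∂μ := fun y =>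
    lintegral_lintegral_swap (Continuous.measurable
      (f := fun p : E × ℝ => h (y + p.2 • (p.1 - y))) (hh.comp (by fun_prop))).aemeasurable
  have hm : Measurable fun p : E × ℝ => ∫⁻ x in s, h (p.1 + p.2 • (x - p.1)) ∂μ :=
    Measurable.lintegral_prod_right' (f := fun p : (E × ℝ) × E => h (p.1.1 + p.1.2 • (p.2 - p.1.1)))
      (Continuous.measurable (hh.comp (by fun_prop)))
  simp only [hin]
  rw [lintegral_lintegral_swap hm.aemeasurable]
  calc _ ≤ ∫⁻ t in Ioc (0 : ℝ) 1, 2 ^ Module.finrank ℝ E * μ s * ∫⁻ x in s, h x ∂μ :=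
        setLIntegral_mono' measurableSet_Ioc fun t ht =>
          lintegral_lintegral_segment_le μ hs hsm hh.measurable ht.1.le ht.2
    _ = _ := by
        rw [setLIntegral_const]
        simp

/-- The fundamental theorem of calculus along a segment, as an upper bound. -/
theorem enorm_sub_le_lintegral_segment {E : Type*} [NormedAddCommGroup E] [NormedSpace ℝ E]
    {f : E → ℝ} (hf : ContDiff ℝ 1 f) (x y : E) :
    ‖f x - f y‖ₑ ≤ ‖x - y‖ₑ * ∫⁻ t in Ioc (0 : ℝ) 1, ‖fderiv ℝ f (y + t • (x - y))‖ₑ := by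
  have hc : Continuous (fderiv ℝ f) := hf.continuous_fderiv one_ne_zero
  have hd : ∀ t ∈ uIcc (0 : ℝ) 1, HasDerivAt (fun t : ℝ => f (y + t • (x - y)))
      (fderiv ℝ f (y + t • (x - y)) (x - y)) t := by
    intro t _
    have h1 : HasDerivAt (fun t : ℝ => y + t • (x - y)) (x - y) t := by
      simpa using ((hasDerivAt_id t).smul_const (x - y)).const_add y
    exact ((hf.differentiable one_ne_zero _).hasFDerivAt).comp_hasDerivAt t h1
  have hi : IntervalIntegrable (fun t : ℝ => fderiv ℝ f (y + t • (x - y)) (x - y)) volume 0 1 :=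
    Continuous.intervalIntegrable (by fun_prop) _ _
  have := intervalIntegral.integral_eq_sub_of_hasDerivAt hd hi
  simp only [one_smul, zero_smul, add_zero, add_sub_cancel] at this
  rw [← this, intervalIntegral.integral_of_le zero_le_one]
  refine (enorm_integral_le_lintegral_enorm _).trans ?_
  rw [← lintegral_const_mul _ (by exact (hc.comp (by fun_prop)).enorm.measurable)]
  refine lintegral_mono fun t => ?_
  rw [mul_comm]
  exact ContinuousLinearMap.le_opENorm _ _

/-- Poincaré inequality for a continuously differentiable function on a convex set. -/
theorem lintegral_lintegral_enorm_sub_le_of_contDiff {E : Type*} [NormedAddCommGroup E]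
    [NormedSpace ℝ E] [FiniteDimensional ℝ E] [MeasurableSpace E] [BorelSpace E] (μ : Measure E)
    [μ.IsAddHaarMeasure] {s : Set E} (hs : Convex ℝ s) (hsm : MeasurableSet s) {D : ENNReal}
    (hDtop : D ≠ ⊤) (hD : ∀ x ∈ s, ∀ y ∈ s, ‖x - y‖ₑ ≤ D) {f : E → ℝ} (hf : ContDiff ℝ 1 f) :
    ∫⁻ y in s, ∫⁻ x in s, ‖f x - f y‖ₑ ∂μ ∂μ ≤
      D * (2 ^ Module.finrank ℝ E * μ s) * ∫⁻ x in s, ‖fderiv ℝ f x‖ₑ ∂μ := by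
  calc ∫⁻ y in s, ∫⁻ x in s, ‖f x - f y‖ₑ ∂μ ∂μ
      ≤ ∫⁻ y in s, ∫⁻ x in s, D * (∫⁻ t in Ioc (0 : ℝ) 1, ‖fderiv ℝ f (y + t • (x - y))‖ₑ) ∂μ ∂μ :=
        setLIntegral_mono' hsm fun y hy => setLIntegral_mono' hsm fun x hx =>
          (enorm_sub_le_lintegral_segment hf x y).trans (by gcongr; exact hD x hx y hy)
    _ = D * ∫⁻ y in s, ∫⁻ x in s, (∫⁻ t in Ioc (0 : ℝ) 1, ‖fderiv ℝ f (y + t • (x - y))‖ₑ) ∂μ ∂μ := by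
        simp only [lintegral_const_mul' D _ hDtop]
    _ ≤ _ := by
        rw [mul_assoc]
        gcongr
        exact lintegral_lintegral_lintegral_segment_le μ hs hsm
          (hf.continuous_fderiv one_ne_zero).enorm

/-! ### Mollification and the local inequality for weak derivatives -/

open ContinuousLinearMap in
/-- Regularising a function by convolution turns its weak derivative into a classical one. -/
theorem HasWeakFDerivOn.fderiv_normed_convolution_apply {m : ℕ}
    {V : Set (EuclideanSpace ℝ (Fin m))}
    {f : EuclideanSpace ℝ (Fin m) → ℝ}
    {F : EuclideanSpace ℝ (Fin m) → (EuclideanSpace ℝ (Fin m) →L[ℝ] ℝ)}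
    (hw : HasWeakFDerivOn V f F) {K : Set (EuclideanSpace ℝ (Fin m))} (hK : IsCompact K)
    (hKV : K ⊆ V) (φ : ContDiffBump (0 : EuclideanSpace ℝ (Fin m))) {x : EuclideanSpace ℝ (Fin m)}
    (hx : Metric.closedBall x φ.rOut ⊆ K) (v : EuclideanSpace ℝ (Fin m)) :
    fderiv ℝ (convolution (φ.normed volume) (K.indicator f) (lsmul ℝ ℝ) volume) x v =
      ∫ t in K, F t v * φ.normed volume (x - t) := by
  set η := φ.normed volume with hη
  have hηs : ContDiff ℝ ∞ η := φ.contDiff_normed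
  have hηc : HasCompactSupport η := φ.hasCompactSupport_normed
  have hint : Integrable (K.indicator f) := by
    rw [integrable_indicator_iff hK.measurableSet]
    exact hw.locallyIntegrableOn.integrableOn_compact_subset hKV hK
  have hd := hηc.hasFDerivAt_convolution_right (lsmul ℝ ℝ).flip hint.locallyIntegrable
    (hηs.of_le (by simp)) x
  rw [convolution_flip] at hd
  rw [hd.fderiv, convolution_precompR_apply _ hint.locallyIntegrable (hηc.fderiv ℝ)
    (hηs.continuous_fderiv (by simp)), convolution_def]
  -- The reflected kernel is an admissible test function, as its support lies in `K ⊆ V`. The minus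
  -- sign from the reflection cancels the one in the weak derivative.
  set ψ : EuclideanSpace ℝ (Fin m) → ℝ := fun t => η (x - t) with hψ
  have hψs : ContDiff ℝ ∞ ψ := hηs.comp (contDiff_const.sub contDiff_id)
  have hψd : ∀ t, fderiv ℝ ψ t v = - fderiv ℝ η (x - t) v := by
    intro t
    have h1 : HasFDerivAt (fun t => x - t) (-ContinuousLinearMap.id ℝ _) t := by
      simpa using (hasFDerivAt_id (𝕜 := ℝ) t).const_sub x
    have h2 := ((hηs.differentiable (by simp)) (x - t)).hasFDerivAt.comp t h1
    rw [show ψ = η ∘ fun t => x - t from rfl, h2.fderiv]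
    simp
  have hts : tsupport ψ ⊆ Metric.closedBall x φ.rOut := by
    refine closure_minimal (fun t ht => ?_) Metric.isClosed_closedBall
    have : x - t ∈ Function.support η := ht
    rw [hη, φ.support_normed_eq, mem_ball_zero_iff] at this
    rw [Metric.mem_closedBall, dist_comm, dist_eq_norm]
    exact this.le
  have hψK : ∀ t ∉ K, ψ t = 0 := fun t ht =>
    image_eq_zero_of_notMem_tsupport fun h => ht (hx (hts h))
  have hψK' : ∀ t ∉ K, fderiv ℝ ψ t v = 0 := fun t ht => by
    rw [image_eq_zero_of_notMem_tsupport (f := fderiv ℝ ψ)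
      fun h => ht (hx (hts (tsupport_fderiv_subset ℝ h)))]
    simp
  have hcs : HasCompactSupport ψ :=
    (isCompact_closedBall x φ.rOut).of_isClosed_subset (isClosed_tsupport ψ) hts
  have hI := hw.integral_eq ψ hψs hcs (hts.trans (hx.trans hKV)) v
  calc ∫ t, (lsmul ℝ ℝ).flip (K.indicator f t) (fderiv ℝ η (x - t) v)
      = ∫ t in V, - (f t * fderiv ℝ ψ t v) := by
        rw [← setIntegral_eq_integral_of_forall_compl_eq_zero (s := V)]
        · congr 1 with t
          rw [hψd]
          by_cases ht : t ∈ K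
          · simp [ht, mul_comm]
          · have := hψK' t ht
            rw [hψd, neg_eq_zero] at this
            simp [this]
        · intro t ht
          simp [indicator_of_notMem (fun h => ht (hKV h))]
    _ = ∫ t in V, F t v * ψ t := by rw [integral_neg, hI, neg_neg]
    _ = ∫ t in V, K.indicator (fun t => F t v * ψ t) t := by
        congr 1 with t
        by_cases ht : t ∈ K
        · rw [indicator_of_mem ht]
        · rw [indicator_of_notMem ht, hψK t ht, mul_zero]
    _ = ∫ t in K, F t v * ψ t := by
        rw [setIntegral_indicator hK.measurableSet, inter_eq_right.2 hKV]

open ContinuousLinearMap in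
/-- Pointwise bound for the derivative of a regularised function. -/
theorem HasWeakFDerivOn.enorm_fderiv_normed_convolution_le {m : ℕ}
    {V : Set (EuclideanSpace ℝ (Fin m))}
    {f : EuclideanSpace ℝ (Fin m) → ℝ}
    {F : EuclideanSpace ℝ (Fin m) → (EuclideanSpace ℝ (Fin m) →L[ℝ] ℝ)}
    (hw : HasWeakFDerivOn V f F) {K : Set (EuclideanSpace ℝ (Fin m))} (hK : IsCompact K)
    (hKV : K ⊆ V) (φ : ContDiffBump (0 : EuclideanSpace ℝ (Fin m))) {x : EuclideanSpace ℝ (Fin m)}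
    (hx : Metric.closedBall x φ.rOut ⊆ K) :
    ‖fderiv ℝ (convolution (φ.normed volume) (K.indicator f) (lsmul ℝ ℝ) volume) x‖ₑ ≤
      ∫⁻ t in K, ‖F t‖ₑ * ‖φ.normed volume (x - t)‖ₑ := by
  refine ContinuousLinearMap.opENorm_le_bound _ fun v => ?_
  rw [hw.fderiv_normed_convolution_apply hK hKV φ hx v,
    ← lintegral_mul_const' _ _ enorm_ne_top]
  refine (enorm_integral_le_lintegral_enorm _).trans (lintegral_mono fun t => ?_)
  rw [enorm_mul, mul_right_comm]
  gcongr
  exact ContinuousLinearMap.le_opENorm _ _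

open ContinuousLinearMap in
/-- The derivative of a regularised function is controlled in `L¹` by the weak derivative. -/
theorem HasWeakFDerivOn.lintegral_enorm_fderiv_normed_convolution_le {m : ℕ}
    {V : Set (EuclideanSpace ℝ (Fin m))}
    {f : EuclideanSpace ℝ (Fin m) → ℝ}
    {F : EuclideanSpace ℝ (Fin m) → (EuclideanSpace ℝ (Fin m) →L[ℝ] ℝ)}
    (hw : HasWeakFDerivOn V f F) {K : Set (EuclideanSpace ℝ (Fin m))} (hK : IsCompact K)
    (hKV : K ⊆ V) (φ : ContDiffBump (0 : EuclideanSpace ℝ (Fin m)))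
    {s : Set (EuclideanSpace ℝ (Fin m))} (hsm : MeasurableSet s)
    (hs : ∀ x ∈ s, Metric.closedBall x φ.rOut ⊆ K) :
    ∫⁻ x in s, ‖fderiv ℝ (convolution (φ.normed volume) (K.indicator f) (lsmul ℝ ℝ) volume) x‖ₑ ≤
      ∫⁻ t in K, ‖F t‖ₑ := by
  have hF : AEMeasurable (fun t => ‖F t‖ₑ) (volume.restrict K) :=
    (hw.locallyIntegrableOn_deriv.integrableOn_compact_subset hKV hK).1.enorm
  have h1 : ∫⁻ x, ‖φ.normed volume x‖ₑ = 1 := by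
    rw [← ofReal_integral_norm_eq_lintegral_enorm φ.integrable_normed]
    simp only [Real.norm_of_nonneg (φ.nonneg_normed _), φ.integral_normed, ENNReal.ofReal_one]
  -- Young's inequality for a kernel of mass one: integrate in `x` first.
  calc _ ≤ ∫⁻ x in s, ∫⁻ t in K, ‖F t‖ₑ * ‖φ.normed volume (x - t)‖ₑ :=
        setLIntegral_mono' hsm fun x hx =>
          hw.enorm_fderiv_normed_convolution_le hK hKV φ (hs x hx)
    _ ≤ ∫⁻ x, ∫⁻ t in K, ‖F t‖ₑ * ‖φ.normed volume (x - t)‖ₑ := setLIntegral_le_lintegral _ _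
    _ = ∫⁻ t in K, ∫⁻ x, ‖F t‖ₑ * ‖φ.normed volume (x - t)‖ₑ := by
        refine lintegral_lintegral_swap (AEMeasurable.mul hF.comp_snd ?_)
        exact ((φ.continuous_normed.comp (by fun_prop)).enorm :
          Continuous fun p : EuclideanSpace ℝ (Fin m) × EuclideanSpace ℝ (Fin m) =>
            ‖φ.normed volume (p.1 - p.2)‖ₑ).measurable.aemeasurable
    _ = ∫⁻ t in K, ‖F t‖ₑ := by
        refine lintegral_congr fun t => ?_
        rw [lintegral_const_mul' _ _ enorm_ne_top,
          lintegral_sub_right_eq_self (fun x => ‖φ.normed volume x‖ₑ), h1, mul_one]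

open Filter in
/-- Fatou's lemma for the mean oscillation. -/
theorem lintegral_lintegral_enorm_sub_le_of_tendsto {α : Type*} [MeasurableSpace α] (μ : Measure α)
    [SFinite μ] {f : α → ℝ} {G : ℕ → α → ℝ} (hG : ∀ n, Measurable (G n))
    (hlim : ∀ᵐ x ∂μ, Tendsto (fun n => G n x) atTop (nhds (f x))) {c : ENNReal}
    (hc : ∀ n, ∫⁻ y, ∫⁻ x, ‖G n x - G n y‖ₑ ∂μ ∂μ ≤ c) :
    ∫⁻ y, ∫⁻ x, ‖f x - f y‖ₑ ∂μ ∂μ ≤ c := by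
  have hm : ∀ n, Measurable fun y => ∫⁻ x, ‖G n x - G n y‖ₑ ∂μ := fun n =>
    Measurable.lintegral_prod_right' (f := fun p : α × α => ‖G n p.2 - G n p.1‖ₑ)
      (((hG n).comp measurable_snd).sub ((hG n).comp measurable_fst)).enorm
  calc ∫⁻ y, ∫⁻ x, ‖f x - f y‖ₑ ∂μ ∂μ
      ≤ ∫⁻ y, liminf (fun n => ∫⁻ x, ‖G n x - G n y‖ₑ ∂μ) atTop ∂μ := by
        refine lintegral_mono_ae ?_
        filter_upwards [hlim] with y hy
        calc ∫⁻ x, ‖f x - f y‖ₑ ∂μ = ∫⁻ x, liminf (fun n => ‖G n x - G n y‖ₑ) atTop ∂μ := by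
              refine lintegral_congr_ae ?_
              filter_upwards [hlim] with x hx
              exact ((hx.sub hy).enorm.liminf_eq).symm
          _ ≤ _ := lintegral_liminf_le fun n => ((hG n).sub measurable_const).enorm
    _ ≤ liminf (fun n => ∫⁻ y, ∫⁻ x, ‖G n x - G n y‖ₑ ∂μ ∂μ) atTop := lintegral_liminf_le hm
    _ ≤ c := by
        refine (liminf_le_liminf (Eventually.of_forall hc)).trans ?_
        simp

open ContinuousLinearMap Filter in
/-- Local Poincaré inequality on a ball for a function with a weak derivative near it. -/
theorem HasWeakFDerivOn.lintegral_lintegral_enorm_sub_le {m : ℕ}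
    {V : Set (EuclideanSpace ℝ (Fin m))}
    {f : EuclideanSpace ℝ (Fin m) → ℝ}
    {F : EuclideanSpace ℝ (Fin m) → (EuclideanSpace ℝ (Fin m) →L[ℝ] ℝ)}
    (hw : HasWeakFDerivOn V f F) {a : EuclideanSpace ℝ (Fin m)} {r : ℝ} (hr : 0 < r)
    (hV : Metric.closedBall a (2 * r) ⊆ V) :
    ∫⁻ y in Metric.ball a r, ∫⁻ x in Metric.ball a r, ‖f x - f y‖ₑ ≤
      ENNReal.ofReal (2 * r) * (2 ^ m * volume (Metric.ball a r)) *
        ∫⁻ x in Metric.closedBall a (2 * r), ‖F x‖ₑ := by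
  set K := Metric.closedBall a (2 * r)
  have hK : IsCompact K := isCompact_closedBall _ _
  have hint : Integrable (K.indicator f) := by
    rw [integrable_indicator_iff hK.measurableSet]
    exact hw.locallyIntegrableOn.integrableOn_compact_subset hV hK
  have hpos : ∀ n : ℕ, 0 < r / (n + 1) := fun n => by positivity
  -- The outer radius is at most `r`, so mollifying at points of the `r`-ball only sees the closed
  -- `2 * r`-ball; the fixed ratio 2 of the radii is what almost everywhere convergence requires.
  let φ : ℕ → ContDiffBump (0 : EuclideanSpace ℝ (Fin m)) := fun n =>
    ⟨r / (n + 1) / 2, r / (n + 1), half_pos (hpos n), half_lt_self (hpos n)⟩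
  have hφ : Tendsto (fun n => (φ n).rOut) atTop (nhds 0) := by
    have := (tendsto_one_div_add_atTop_nhds_zero_nat (𝕜 := ℝ)).const_mul r
    simpa [φ, div_eq_mul_inv] using this
  have hφr : ∀ n, (φ n).rOut ≤ r := fun n => div_le_self hr.le (by simp)
  have hlim := ContDiffBump.ae_convolution_tendsto_right_of_locallyIntegrable (K := 2) hφ
    (Eventually.of_forall fun n => by simp only [φ]; linarith) hint.locallyIntegrable
  have hcd : ∀ n, ContDiff ℝ 1 (convolution ((φ n).normed volume) (K.indicator f) (lsmul ℝ ℝ)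
      volume) := fun n =>
    (φ n).hasCompactSupport_normed.contDiff_convolution_left _ (φ n).contDiff_normed
      hint.locallyIntegrable
  have hsub : Metric.ball a r ⊆ K :=
    Metric.ball_subset_closedBall.trans (Metric.closedBall_subset_closedBall (by linarith))
  refine lintegral_lintegral_enorm_sub_le_of_tendsto _ (fun n => (hcd n).continuous.measurable)
    ?_ fun n => ?_
  · filter_upwards [ae_restrict_of_ae hlim, ae_restrict_mem Metric.isOpen_ball.measurableSet]
      with x hx hxb
    rwa [indicator_of_mem (hsub hxb)] at hx
  · refine (lintegral_lintegral_enorm_sub_le_of_contDiff volume (convex_ball a r)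
      Metric.isOpen_ball.measurableSet (D := ENNReal.ofReal (2 * r)) ENNReal.ofReal_ne_top
      (fun x hx y hy => ?_) (hcd n)).trans ?_
    · rw [← ofReal_norm, ← dist_eq_norm]
      apply ENNReal.ofReal_le_ofReal
      have := dist_triangle_right x y a
      rw [Metric.mem_ball] at hx hy
      linarith
    · rw [finrank_euclideanSpace_fin]
      refine mul_le_mul_right ?_ _
      refine hw.lintegral_enorm_fderiv_normed_convolution_le hK hV (φ n)
        Metric.isOpen_ball.measurableSet fun x hx => ?_
      refine Metric.closedBall_subset_closedBall' ?_
      have := hφr n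
      rw [Metric.mem_ball] at hx
      linarith

/-! ### Bi-Lipschitz charts and comparison of measures -/

open scoped NNReal in
theorem LipschitzOnWith.euclideanHausdorffMeasure_image_le {X Y : Type*} [EMetricSpace X]
    [EMetricSpace Y] [MeasurableSpace X] [BorelSpace X] [MeasurableSpace Y] [BorelSpace Y]
    {K : ℝ≥0} {f : X → Y} {s : Set X} (h : LipschitzOnWith K f s) (d : ℕ) :
    Measure.euclideanHausdorffMeasure d (f '' s) ≤
      (K : ENNReal) ^ d * Measure.euclideanHausdorffMeasure d s := by
  simp only [Measure.euclideanHausdorffMeasure_def, Measure.smul_apply]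
  rw [mul_smul_comm]
  gcongr
  simpa using h.hausdorffMeasure_image_le (d := d) (Nat.cast_nonneg d)

open scoped NNReal in
/-- The surface measure on a Lipschitz image is controlled by the push-forward of the volume. -/
theorem LipschitzOnWith.restrict_euclideanHausdorffMeasure_image_le {m N : ℕ} {K : ℝ≥0}
    {ψ : EuclideanSpace ℝ (Fin m) → EuclideanSpace ℝ (Fin N)} {B : Set (EuclideanSpace ℝ (Fin m))}
    (h : LipschitzOnWith K ψ B) (hB : MeasurableSet B) :
    (Measure.euclideanHausdorffMeasure m).restrict (ψ '' B) ≤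
      ((K : ENNReal) ^ m) • (volume.restrict B).map ψ := by
  have hψ : AEMeasurable ψ (volume.restrict B) := h.continuousOn.aemeasurable hB
  refine Measure.le_iff.2 fun A hA => ?_
  rw [Measure.restrict_apply hA, Measure.smul_apply, Measure.map_apply_of_aemeasurable hψ hA,
    Measure.restrict_apply' hB, inter_comm A, ← image_inter_preimage, inter_comm B,
    ← EuclideanSpace.euclideanHausdorffMeasure_eq_volume]
  exact (h.mono inter_subset_right).euclideanHausdorffMeasure_image_le m

open scoped NNReal in
/-- The push-forward of the volume under a map with Lipschitz inverse is controlled by the surface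
measure on the image. -/
theorem LipschitzOnWith.map_restrict_volume_le {m N : ℕ} {K : ℝ≥0}
    {ψ : EuclideanSpace ℝ (Fin m) → EuclideanSpace ℝ (Fin N)} {B : Set (EuclideanSpace ℝ (Fin m))}
    {χ : EuclideanSpace ℝ (Fin N) → EuclideanSpace ℝ (Fin m)}
    (h : LipschitzOnWith K χ (ψ '' B)) (hχ : LeftInvOn χ ψ B) (hψ : ContinuousOn ψ B)
    (hB : MeasurableSet B) :
    (volume.restrict B).map ψ ≤
      ((K : ENNReal) ^ m) • (Measure.euclideanHausdorffMeasure m).restrict (ψ '' B) := by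
  refine Measure.le_iff.2 fun A hA => ?_
  rw [Measure.smul_apply, Measure.map_apply_of_aemeasurable (hψ.aemeasurable hB) hA,
    Measure.restrict_apply hA, Measure.restrict_apply' hB, inter_comm A, ← image_inter_preimage,
    inter_comm _ B, ← EuclideanSpace.euclideanHausdorffMeasure_eq_volume]
  conv_lhs => rw [← (hχ.mono inter_subset_left : LeftInvOn χ ψ (B ∩ ψ ⁻¹' A)).image_image]
  exact (h.mono (image_mono inter_subset_left)).euclideanHausdorffMeasure_image_le m

open scoped NNReal Topology in
/-- A strictly differentiable map with injective derivative is bi-Lipschitz near the point. -/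
theorem HasStrictFDerivAt.exists_biLipschitz {E F : Type*} [NormedAddCommGroup E]
    [NormedSpace ℝ E] [FiniteDimensional ℝ E] [NormedAddCommGroup F] [NormedSpace ℝ F]
    {f : E → F} {f' : E →L[ℝ] F} {a : E} (hf : HasStrictFDerivAt f f' a)
    (hf' : Function.Injective f') :
    ∃ s ∈ 𝓝 a, ∃ K K' : ℝ≥0, LipschitzOnWith K f s ∧
      ∀ x ∈ s, ∀ y ∈ s, edist x y ≤ K' * edist (f x) (f y) := by
  obtain ⟨k, hk, hanti⟩ := f'.toLinearMap.injective_iff_antilipschitz.1 hf'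
  obtain ⟨K, s, hs, hL⟩ := hf.exists_lipschitzOnWith
  -- The linear map expands distances by at least `k⁻¹`; an error of Lipschitz constant half as
  -- large leaves a positive lower bound.
  obtain ⟨t, ht, happ⟩ := hf.approximates_deriv_on_nhds (c := k⁻¹ / 2)
    (Or.inr (by positivity))
  have h1 : AntilipschitzWith k (t.domRestrict f') := hanti.domRestrict t
  have h2 := h1.add_lipschitzWith happ.lipschitz_sub
    (NNReal.half_lt_self (inv_pos.2 hk).ne')
  refine ⟨s ∩ t, Filter.inter_mem hs ht, K, (k⁻¹ - k⁻¹ / 2)⁻¹, hL.mono inter_subset_left,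
    fun x hx y hy => ?_⟩
  have := h2 ⟨x, hx.2⟩ ⟨y, hy.2⟩
  simpa using this

open scoped NNReal in
/-- A local parametrization is bi-Lipschitz near each point. -/
theorem IsLocalParametrization.exists_biLipschitz {N : ℕ} {M : Set (EuclideanSpace ℝ (Fin N))}
    {V : Set (EuclideanSpace ℝ (Fin (N - 1)))} {U : Set (EuclideanSpace ℝ (Fin N))}
    {ψ : EuclideanSpace ℝ (Fin (N - 1)) → EuclideanSpace ℝ (Fin N)}
    (h : IsLocalParametrization M V U ψ) {y₀ : EuclideanSpace ℝ (Fin (N - 1))} (hy₀ : y₀ ∈ V) :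
    ∃ T ⊆ V, IsOpen T ∧ y₀ ∈ T ∧ ∃ (K K' : ℝ≥0)
      (χ : EuclideanSpace ℝ (Fin N) → EuclideanSpace ℝ (Fin (N - 1))),
      LipschitzOnWith K ψ T ∧ LeftInvOn χ ψ T ∧ LipschitzOnWith K' χ (ψ '' T) := by
  have hs : HasStrictFDerivAt ψ (fderiv ℝ ψ y₀) y₀ :=
    (h.contDiffOn.contDiffAt (h.isOpen_domain.mem_nhds hy₀)).hasStrictFDerivAt (by simp)
  obtain ⟨s, hs, K, K', hL, hA⟩ := hs.exists_biLipschitz (h.injective_fderiv y₀ hy₀)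
  obtain ⟨χ, -, hχ⟩ := h.exists_continuous_inverse
  obtain ⟨T, hTs, hTo, hT⟩ := mem_nhds_iff.1 (Filter.inter_mem hs (h.isOpen_domain.mem_nhds hy₀))
  refine ⟨T, hTs.trans inter_subset_right, hTo, hT, K, K', χ,
    hL.mono (hTs.trans inter_subset_left), hχ.mono (hTs.trans inter_subset_right), ?_⟩
  rintro _ ⟨x, hx, rfl⟩ _ ⟨y, hy, rfl⟩
  rw [hχ (hTs hx).2, hχ (hTs hy).2]
  exact hA x (hTs hx).1 y (hTs hy).1

/-- The image of an open set under a local parametrization is relatively open. -/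
theorem IsLocalParametrization.exists_isOpen_image_eq {N : ℕ}
    {M : Set (EuclideanSpace ℝ (Fin N))}
    {V : Set (EuclideanSpace ℝ (Fin (N - 1)))} {U : Set (EuclideanSpace ℝ (Fin N))}
    {ψ : EuclideanSpace ℝ (Fin (N - 1)) → EuclideanSpace ℝ (Fin N)}
    (h : IsLocalParametrization M V U ψ) {B : Set (EuclideanSpace ℝ (Fin (N - 1)))}
    (hB : IsOpen B) (hBV : B ⊆ V) : ∃ O, IsOpen O ∧ ψ '' B = M ∩ O := by
  obtain ⟨χ, hχc, hχ⟩ := h.exists_continuous_inverse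
  obtain ⟨O, hO, hOe⟩ := continuousOn_iff'.1 hχc B hB
  refine ⟨O ∩ U, hO.inter h.isOpen_target, ?_⟩
  ext x
  constructor
  · rintro ⟨y, hy, rfl⟩
    have hm : ψ y ∈ M ∩ U := h.image_eq ▸ mem_image_of_mem ψ (hBV hy)
    have h2 : ψ y ∈ O ∩ (M ∩ U) := hOe ▸ ⟨by rw [mem_preimage, hχ (hBV hy)]; exact hy, hm⟩
    exact ⟨hm.1, h2.1, hm.2⟩
  · rintro ⟨hM, hxO, hU⟩
    obtain ⟨y, hy, rfl⟩ : x ∈ ψ '' V := h.image_eq ▸ ⟨hM, hU⟩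
    have h2 : ψ y ∈ χ ⁻¹' B ∩ (M ∩ U) := hOe ▸ ⟨hxO, hM, hU⟩
    have h3 := h2.1
    rw [mem_preimage, hχ hy] at h3
    exact ⟨y, h3, rfl⟩

/-- Nonempty relatively open subsets of a hypersurface have positive surface measure. -/
theorem IsSmoothHypersurface.measure_pos {N : ℕ} {M : Set (EuclideanSpace ℝ (Fin N))}
    (hM : IsSmoothHypersurface M) {O : Set (EuclideanSpace ℝ (Fin N))} (hO : IsOpen O)
    (hne : (M ∩ O).Nonempty) : Measure.euclideanHausdorffMeasure (N - 1) (M ∩ O) ≠ 0 := by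
  obtain ⟨p, hpM, hpO⟩ := hne
  obtain ⟨V, U, ψ, h, hpU⟩ := hM p hpM
  obtain ⟨y₀, hy₀, rfl⟩ : p ∈ ψ '' V := h.image_eq ▸ ⟨hpM, hpU⟩
  obtain ⟨T, hTV, hTo, hT, K, K', χ, hK, hχ, hK'⟩ := h.exists_biLipschitz hy₀
  have hop : IsOpen (T ∩ ψ ⁻¹' O) := hK.continuousOn.isOpen_inter_preimage hTo hO
  have hpos := hop.measure_pos volume ⟨y₀, hT, hpO⟩
  intro h0
  -- The Lipschitz inverse would carry a null set of M onto a nonempty open set of parameters.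
  have hle := (hK'.mono (image_mono (inter_subset_left (t := ψ ⁻¹' O))))
    |>.euclideanHausdorffMeasure_image_le (N - 1)
  rw [(hχ.mono inter_subset_left : LeftInvOn χ ψ (T ∩ ψ ⁻¹' O)).image_image,
    EuclideanSpace.euclideanHausdorffMeasure_eq_volume, measure_mono_null ?_ h0, mul_zero] at hle
  · exact hpos.ne' (le_antisymm hle zero_le)
  · rintro _ ⟨y, hy, rfl⟩
    exact ⟨(h.image_eq ▸ mem_image_of_mem ψ (hTV hy.1) : ψ y ∈ M ∩ U).1, hy.2⟩

/-! ### Mean oscillation and gluing -/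

/-- The (unnormalised) mean oscillation `∫∫ |f x - f y| dμ(x) dμ(y)` of a function. -/
noncomputable def meanOscillation {α : Type*} [MeasurableSpace α] (μ : Measure α) (f : α → ℝ) :
    ENNReal :=
  ∫⁻ y, ∫⁻ x, ‖f x - f y‖ₑ ∂μ ∂μ

theorem meanOscillation_congr {α : Type*} [MeasurableSpace α] {μ : Measure α} {f f' : α → ℝ}
    (h : f =ᵐ[μ] f') : meanOscillation μ f = meanOscillation μ f' := by
  refine lintegral_congr_ae ?_
  filter_upwards [h] with y hy
  refine lintegral_congr_ae ?_
  filter_upwards [h] with x hx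
  rw [hx, hy]

theorem meanOscillation_mono {α : Type*} [MeasurableSpace α] {μ ν : Measure α} (h : μ ≤ ν)
    (f : α → ℝ) : meanOscillation μ f ≤ meanOscillation ν f :=
  lintegral_mono' h fun _ => lintegral_mono' h fun _ => le_rfl

theorem meanOscillation_smul {α : Type*} [MeasurableSpace α] (μ : Measure α) {c : ENNReal}
    (hc : c ≠ ⊤) (f : α → ℝ) : meanOscillation (c • μ) f = c * c * meanOscillation μ f := by
  simp only [meanOscillation, lintegral_smul_measure, smul_eq_mul]
  rw [lintegral_const_mul' _ _ hc, mul_assoc]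

theorem measurable_lintegral_enorm_sub {α : Type*} [MeasurableSpace α] (μ : Measure α) [SFinite μ]
    {f : α → ℝ} (hf : Measurable f) : Measurable fun y => ∫⁻ x, ‖f x - f y‖ₑ ∂μ :=
  Measurable.lintegral_prod_right' (f := fun p : α × α => ‖f p.2 - f p.1‖ₑ)
    ((hf.comp measurable_snd).sub (hf.comp measurable_fst)).enorm

theorem meanOscillation_map {α β : Type*} [MeasurableSpace α] [MeasurableSpace β] {μ : Measure α}
    [SFinite μ] {ψ : α → β} (hψ : AEMeasurable ψ μ) {f : β → ℝ} (hf : Measurable f) :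
    meanOscillation (μ.map ψ) f = meanOscillation μ (f ∘ ψ) := by
  have hin : ∀ z, ∫⁻ x, ‖f x - z‖ₑ ∂(μ.map ψ) = ∫⁻ x, ‖f (ψ x) - z‖ₑ ∂μ := fun z =>
    lintegral_map' ((hf.sub measurable_const).enorm.aemeasurable) hψ
  rw [meanOscillation, lintegral_map' (measurable_lintegral_enorm_sub _ hf).aemeasurable hψ]
  simp only [hin, meanOscillation, Function.comp]

/-- The mixed oscillation is controlled by the oscillations with respect to two measures and the
mass of a common minorant. -/
theorem mul_lintegral_lintegral_enorm_sub_le {α : Type*} [MeasurableSpace α] {μ ν ρ : Measure α}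
    [IsFiniteMeasure μ] [IsFiniteMeasure ν] (hμ : ρ ≤ μ) (hν : ρ ≤ ν) {f : α → ℝ}
    (hf : Measurable f) :
    ρ univ * ∫⁻ y, ∫⁻ x, ‖f x - f y‖ₑ ∂ν ∂μ ≤
      μ univ * meanOscillation ν f + ν univ * meanOscillation μ f := by
  have hρ : ρ univ ≠ ⊤ := ((hμ univ).trans_lt (measure_lt_top μ univ)).ne
  -- Triangle inequality through a point `z` of the overlap, integrated over `ρ`; each term is then
  -- enlarged to the measure its other variable belongs to.
  have key : ∀ y x, ρ univ * ‖f x - f y‖ₑ ≤ (∫⁻ z, ‖f z - f x‖ₑ ∂ν) + ∫⁻ z, ‖f z - f y‖ₑ ∂μ := by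
    intro y x
    calc ρ univ * ‖f x - f y‖ₑ = ∫⁻ _, ‖f x - f y‖ₑ ∂ρ := by rw [lintegral_const, mul_comm]
      _ ≤ ∫⁻ z, (‖f z - f x‖ₑ + ‖f z - f y‖ₑ) ∂ρ := by
          refine lintegral_mono fun z => ?_
          rw [enorm_sub_rev (f z)]
          calc ‖f x - f y‖ₑ = ‖(f x - f z) + (f z - f y)‖ₑ := by rw [sub_add_sub_cancel]
            _ ≤ _ := enorm_add_le _ _
      _ = (∫⁻ z, ‖f z - f x‖ₑ ∂ρ) + ∫⁻ z, ‖f z - f y‖ₑ ∂ρ :=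
          lintegral_add_left (hf.sub measurable_const).enorm _
      _ ≤ _ := add_le_add (lintegral_mono' hν fun _ => le_rfl) (lintegral_mono' hμ fun _ => le_rfl)
  calc ρ univ * ∫⁻ y, ∫⁻ x, ‖f x - f y‖ₑ ∂ν ∂μ
      = ∫⁻ y, ∫⁻ x, ρ univ * ‖f x - f y‖ₑ ∂ν ∂μ := by
        simp only [lintegral_const_mul' _ _ hρ]
    _ ≤ ∫⁻ y, ∫⁻ x, ((∫⁻ z, ‖f z - f x‖ₑ ∂ν) + ∫⁻ z, ‖f z - f y‖ₑ ∂μ) ∂ν ∂μ :=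
        lintegral_mono fun y => lintegral_mono fun x => key y x
    _ = ∫⁻ y, (meanOscillation ν f + ν univ * ∫⁻ z, ‖f z - f y‖ₑ ∂μ) ∂μ := by
        refine lintegral_congr fun y => ?_
        rw [lintegral_add_left (measurable_lintegral_enorm_sub ν hf), lintegral_const, mul_comm]
        rfl
    _ = _ := by
        rw [lintegral_add_left measurable_const, lintegral_const,
          lintegral_const_mul' _ _ (measure_ne_top ν univ), mul_comm (meanOscillation ν f)]
        rfl

/-- The oscillation with respect to a sum of two overlapping measures. -/
theorem meanOscillation_add_le {α : Type*} [MeasurableSpace α] {μ ν ρ : Measure α}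
    [IsFiniteMeasure μ] [IsFiniteMeasure ν] (hμ : ρ ≤ μ) (hν : ρ ≤ ν) (hρ : ρ univ ≠ 0) {f : α → ℝ}
    (hf : Measurable f) :
    meanOscillation (μ + ν) f ≤ meanOscillation μ f + meanOscillation ν f +
      2 * ((ρ univ)⁻¹ * (μ univ * meanOscillation ν f + ν univ * meanOscillation μ f)) := by
  have hρt : ρ univ ≠ ⊤ := ((hμ univ).trans_lt (measure_lt_top μ univ)).ne
  have h1 := mul_lintegral_lintegral_enorm_sub_le hμ hν hf
  have h2 := mul_lintegral_lintegral_enorm_sub_le hν hμ hf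
  rw [ENNReal.mul_le_iff_le_inv hρ hρt] at h1 h2
  rw [add_comm (ν univ * _)] at h2
  -- The product of μ + ν with itself has two pure and two mixed terms.
  have hsum : meanOscillation (μ + ν) f = (meanOscillation μ f + ∫⁻ y, ∫⁻ x, ‖f x - f y‖ₑ ∂ν ∂μ) +
      ((∫⁻ y, ∫⁻ x, ‖f x - f y‖ₑ ∂μ ∂ν) + meanOscillation ν f) := by
    simp only [meanOscillation, lintegral_add_measure]
    rw [lintegral_add_left (measurable_lintegral_enorm_sub μ hf),
      lintegral_add_left (measurable_lintegral_enorm_sub μ hf)]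
  rw [hsum]
  calc _ ≤ (meanOscillation μ f +
          (ρ univ)⁻¹ * (μ univ * meanOscillation ν f + ν univ * meanOscillation μ f)) +
        ((ρ univ)⁻¹ * (μ univ * meanOscillation ν f + ν univ * meanOscillation μ f) +
          meanOscillation ν f) := by gcongr
    _ = _ := by ring

/-! ### Poincaré sets on a hypersurface -/

/-- A set of finite surface measure on which the mean oscillation of every function in `W^{1,1}(M)`
is controlled by the `L¹` norm of its gradient on `M`. -/
def IsPoincareSet {N : ℕ} (M A : Set (EuclideanSpace ℝ (Fin N))) : Prop :=
  Measure.euclideanHausdorffMeasure (N - 1) A ≠ ⊤ ∧ ∃ C : ENNReal, C ≠ ⊤ ∧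
    ∀ (u : EuclideanSpace ℝ (Fin N) → ℝ) (g : EuclideanSpace ℝ (Fin N) → EuclideanSpace ℝ (Fin N)),
      MemW11 M u g → meanOscillation ((Measure.euclideanHausdorffMeasure (N - 1)).restrict A) u ≤
        C * ∫⁻ x, ‖g x‖ₑ ∂surfaceMeasure M

/-- Overlapping Poincaré sets can be glued. -/
theorem IsPoincareSet.union {N : ℕ} {M A B : Set (EuclideanSpace ℝ (Fin N))}
    (hA : IsPoincareSet M A) (hB : IsPoincareSet M B) (hAM : A ⊆ M) (hBM : B ⊆ M)
    (hAB : Measure.euclideanHausdorffMeasure (N - 1) (A ∩ B) ≠ 0) : IsPoincareSet M (A ∪ B) := by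
  obtain ⟨hAt, C₁, hC₁, h₁⟩ := hA
  obtain ⟨hBt, C₂, hC₂, h₂⟩ := hB
  set H : Measure (EuclideanSpace ℝ (Fin N)) := Measure.euclideanHausdorffMeasure (N - 1) with hH
  have : IsFiniteMeasure (H.restrict A) := isFiniteMeasure_restrict.2 hAt
  have : IsFiniteMeasure (H.restrict B) := isFiniteMeasure_restrict.2 hBt
  refine ⟨measure_union_ne_top hAt hBt,
    C₁ + C₂ + 2 * ((H (A ∩ B))⁻¹ * (H A * C₂ + H B * C₁)), ?_, fun u g hu => ?_⟩
  · finiteness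
  -- The gluing estimate needs a measurable function; oscillation depends only on the almost
  -- everywhere class.
  · obtain ⟨v, hv, huv⟩ := hu.memLp.1.aemeasurable
    have hcongr : ∀ D ⊆ M, meanOscillation (H.restrict D) u = meanOscillation (H.restrict D) v :=
      fun D hD => meanOscillation_congr (ae_restrict_of_ae_restrict_of_subset hD huv)
    have h₁ := h₁ u g hu
    have h₂ := h₂ u g hu
    rw [hcongr A hAM] at h₁
    rw [hcongr B hBM] at h₂
    rw [hcongr _ (union_subset hAM hBM)]
    have hadd := meanOscillation_add_le (μ := H.restrict A) (ν := H.restrict B)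
      (ρ := H.restrict (A ∩ B)) (Measure.restrict_mono_set _ inter_subset_left)
      (Measure.restrict_mono_set _ inter_subset_right) (by simpa using hAB) hv
    simp only [Measure.restrict_apply_univ] at hadd
    set G := ∫⁻ x, ‖g x‖ₑ ∂surfaceMeasure M
    calc _ ≤ _ := meanOscillation_mono (Measure.restrict_union_le A B) v
      _ ≤ _ := hadd
      _ ≤ C₁ * G + C₂ * G + 2 * ((H (A ∩ B))⁻¹ * (H A * (C₂ * G) + H B * (C₁ * G))) := by gcongr
      _ = _ := by ring

open Metric in
/-- Every point of a hypersurface has a relatively open neighbourhood that is a Poincaré set. -/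
theorem IsSmoothHypersurface.exists_isPoincareSet {N : ℕ} {M : Set (EuclideanSpace ℝ (Fin N))}
    (hM : IsSmoothHypersurface M) {p : EuclideanSpace ℝ (Fin N)} (hp : p ∈ M) :
    ∃ O, IsOpen O ∧ p ∈ O ∧ IsPoincareSet M (M ∩ O) := by
  obtain ⟨V, U, ψ, h, hpU⟩ := hM p hp
  obtain ⟨y₀, hy₀, rfl⟩ : p ∈ ψ '' V := h.image_eq ▸ ⟨hp, hpU⟩
  obtain ⟨T, hTV, hTo, hT, K, K', χ, hK, hχ, hK'⟩ := h.exists_biLipschitz hy₀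
  obtain ⟨ε, hε, hεT⟩ := nhds_basis_closedBall.mem_iff.1 (hTo.mem_nhds hT)
  obtain ⟨r, hr, rfl⟩ : ∃ r, 0 < r ∧ ε = 2 * r := ⟨ε / 2, by positivity, by ring⟩
  have hBK : ball y₀ r ⊆ closedBall y₀ (2 * r) :=
    ball_subset_closedBall.trans (closedBall_subset_closedBall (by linarith))
  have hBT : ball y₀ r ⊆ T := hBK.trans hεT
  have hBm : MeasurableSet (ball y₀ r) := isOpen_ball.measurableSet
  have hBc : MeasurableSet (closedBall y₀ (2 * r)) := isClosed_closedBall.measurableSet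
  have hTM : ∀ {B}, B ⊆ T → ψ '' B ⊆ M := fun hB =>
    (image_mono (hB.trans hTV)).trans (h.image_eq.subset.trans inter_subset_left)
  obtain ⟨O, hO, hOe⟩ := h.exists_isOpen_image_eq isOpen_ball (hBT.trans hTV)
  have hpO : ψ y₀ ∈ M ∩ O := hOe ▸ mem_image_of_mem ψ (mem_ball_self hr)
  refine ⟨O, hO, hpO.2, ?_⟩
  rw [← hOe]
  set H : Measure (EuclideanSpace ℝ (Fin N)) := Measure.euclideanHausdorffMeasure (N - 1) with hH
  have hup := (hK.mono hBT).restrict_euclideanHausdorffMeasure_image_le hBm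
  have hlow := fun {B} (hB : B ⊆ T) (hm : MeasurableSet B) =>
    (hK'.mono (image_mono hB)).map_restrict_volume_le (hχ.mono hB) (hK.continuousOn.mono hB) hm
  have hψB : AEMeasurable ψ (volume.restrict (ball y₀ r)) :=
    (hK.continuousOn.mono hBT).aemeasurable hBm
  have hψC : AEMeasurable ψ (volume.restrict (closedBall y₀ (2 * r))) :=
    (hK.continuousOn.mono hεT).aemeasurable hBc
  have hvol : volume (ball y₀ r) ≠ ⊤ := measure_ball_lt_top.ne
  -- `K ^ (N - 1)` occurs twice because oscillation is quadratic in the measure. The middle factor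
  -- is the constant on the ball; `K` bounds `‖Dψ‖`, and `K' ^ (N - 1)` returns the gradient
  -- integral to M.
  refine ⟨?_, (K : ENNReal) ^ (N - 1) * (K : ENNReal) ^ (N - 1) *
    (ENNReal.ofReal (2 * r) * (2 ^ (N - 1) * volume (ball y₀ r)) *
      (K * (K' : ENNReal) ^ (N - 1))), by finiteness, fun u g hu => ?_⟩
  · have h1 := (hK.mono hBT).euclideanHausdorffMeasure_image_le (N - 1)
    rw [EuclideanSpace.euclideanHausdorffMeasure_eq_volume] at h1
    exact (h1.trans_lt (by finiteness)).ne
  · obtain ⟨v, hv, huv⟩ := hu.memLp.1.aemeasurable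
    have huvB : u =ᵐ[H.restrict (ψ '' ball y₀ r)] v :=
      ae_restrict_of_ae_restrict_of_subset (hTM hBT) huv
    -- This lets equality almost everywhere on M be pulled back to the chart.
    have hac : (volume.restrict (ball y₀ r)).map ψ ≪ H.restrict (ψ '' ball y₀ r) :=
      (Measure.absolutelyContinuous_of_le (hlow hBT hBm)).trans Measure.smul_absolutelyContinuous
    have huvψ : v ∘ ψ =ᵐ[volume.restrict (ball y₀ r)] fun y => u (ψ y) :=
      (ae_of_ae_map hψB (hac.ae_le huvB)).mono fun y hy => hy.symm
    have hg : AEMeasurable (fun x => ‖g x‖ₑ)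
        ((volume.restrict (closedBall y₀ (2 * r))).map ψ) := by
      refine AEMeasurable.mono_ac (ν := surfaceMeasure M) hu.memLp_gradient.1.enorm ?_
      refine ((Measure.absolutelyContinuous_of_le (hlow hεT hBc)).trans
        Measure.smul_absolutelyContinuous).trans ?_
      exact Measure.absolutelyContinuous_of_le (Measure.restrict_mono_set _ (hTM hεT))
    have hgrad : ∫⁻ y in closedBall y₀ (2 * r), ‖(innerSL ℝ (g (ψ y))).comp (fderiv ℝ ψ y)‖ₑ ≤
        K * (K' : ENNReal) ^ (N - 1) * ∫⁻ x, ‖g x‖ₑ ∂surfaceMeasure M := by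
      calc _ ≤ ∫⁻ y in closedBall y₀ (2 * r), K * ‖g (ψ y)‖ₑ := by
            refine setLIntegral_mono' hBc fun y hy => ?_
            have hd : ‖fderiv ℝ ψ y‖ ≤ K :=
              norm_fderiv_le_of_lipschitzOn ℝ (hTo.mem_nhds (hεT hy)) hK
            have : ‖(innerSL ℝ (g (ψ y))).comp (fderiv ℝ ψ y)‖ ≤ K * ‖g (ψ y)‖ := by
              refine (ContinuousLinearMap.opNorm_comp_le _ _).trans ?_
              rw [innerSL_apply_norm, mul_comm]
              gcongr
            rw [← ofReal_norm, ← ofReal_norm]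
            refine (ENNReal.ofReal_le_ofReal this).trans ?_
            rw [ENNReal.ofReal_mul K.coe_nonneg, ENNReal.ofReal_coe_nnreal]
        _ = K * ∫⁻ x, ‖g x‖ₑ ∂((volume.restrict (closedBall y₀ (2 * r))).map ψ) := by
            rw [lintegral_const_mul' _ _ ENNReal.coe_ne_top, lintegral_map' hg hψC]
        _ ≤ K * ∫⁻ x, ‖g x‖ₑ ∂(((K' : ENNReal) ^ (N - 1)) •
              H.restrict (ψ '' closedBall y₀ (2 * r))) := by
            gcongr
            exact hlow hεT hBc
        _ ≤ _ := by
            rw [lintegral_smul_measure, smul_eq_mul, mul_assoc]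
            gcongr
            exact Measure.restrict_mono_set _ (hTM hεT)
    have hloc := (hu.hasWeakTangentialGradient.weak_deriv V U ψ h).lintegral_lintegral_enorm_sub_le
      hr (hεT.trans hTV)
    calc meanOscillation (H.restrict (ψ '' ball y₀ r)) u
        = meanOscillation (H.restrict (ψ '' ball y₀ r)) v := meanOscillation_congr huvB
      _ ≤ _ := meanOscillation_mono hup v
      _ = (K : ENNReal) ^ (N - 1) * (K : ENNReal) ^ (N - 1) *
          meanOscillation (volume.restrict (ball y₀ r)) (fun y => u (ψ y)) := by
          rw [meanOscillation_smul _ (by finiteness), meanOscillation_map hψB hv,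
            meanOscillation_congr huvψ]
      _ ≤ _ := mul_le_mul_right (hloc.trans (mul_le_mul_right hgrad _)) _
      _ = _ := by ring

/-- A compact connected hypersurface is a Poincaré set. -/
theorem IsSmoothHypersurface.isPoincareSet {N : ℕ} {M : Set (EuclideanSpace ℝ (Fin N))}
    (hM : IsSmoothHypersurface M) (hcompact : IsCompact M) (hconn : IsConnected M) :
    IsPoincareSet M M := by
  obtain ⟨p₀, hp₀⟩ := hconn.nonempty
  have hunion : ∀ O O', IsOpen O → IsOpen O' → IsPoincareSet M (M ∩ O) →
      IsPoincareSet M (M ∩ O') → (M ∩ (O ∩ O')).Nonempty → IsPoincareSet M (M ∩ (O ∪ O')) := by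
    intro O O' hO hO' h h' hne
    rw [inter_union_distrib_left]
    refine h.union h' inter_subset_left inter_subset_left ?_
    rw [← inter_inter_distrib_left]
    exact hM.measure_pos (hO.inter hO') hne
  -- every point of `M` lies with `p₀` in a common relatively open Poincaré set
  have hjoin : ∀ p ∈ M, ∃ O, IsOpen O ∧ p₀ ∈ O ∧ p ∈ O ∧ IsPoincareSet M (M ∩ O) := by
    -- `E` collects the points joined to `p₀`. A Poincaré neighbourhood meeting `E` on M can be
    -- glued to a member of `E`, so a point of M outside `E` lies in `E'`; the two open sets would
    -- disconnect M.
    let E : Set (EuclideanSpace ℝ (Fin N)) :=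
      ⋃₀ {O | IsOpen O ∧ p₀ ∈ O ∧ IsPoincareSet M (M ∩ O)}
    let E' : Set (EuclideanSpace ℝ (Fin N)) :=
      ⋃₀ {O | IsOpen O ∧ IsPoincareSet M (M ∩ O) ∧ M ∩ O ∩ E = ∅}
    by_contra! hcon
    obtain ⟨q, hq, hqE⟩ := hcon
    have hqE : q ∉ E := by
      rintro ⟨O, ⟨hO, hpO, hP⟩, hqO⟩
      exact hqE O hO hpO hqO hP
    have hE : IsOpen E := isOpen_sUnion fun O hO => hO.1
    have hE' : IsOpen E' := isOpen_sUnion fun O hO => hO.1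
    have hdich : ∀ x ∈ M, x ∉ E → x ∈ E' := by
      intro x hx hxE
      obtain ⟨O, hO, hxO, hP⟩ := hM.exists_isPoincareSet hx
      refine ⟨O, ⟨hO, hP, ?_⟩, hxO⟩
      by_contra hne
      obtain ⟨z, ⟨hzM, hzO⟩, O', ⟨hO', hpO', hP'⟩, hzO'⟩ := nonempty_iff_ne_empty.2 hne
      exact hxE ⟨O ∪ O', ⟨hO.union hO', Or.inr hpO',
        hunion O O' hO hO' hP hP' ⟨z, hzM, hzO, hzO'⟩⟩, Or.inl hxO⟩
    obtain ⟨O₀, hO₀, hpO₀, hP₀⟩ := hM.exists_isPoincareSet hp₀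
    obtain ⟨x, hxM, hxE, O, ⟨hO, hP, hdis⟩, hxO⟩ := hconn.isPreconnected E E' hE hE'
      (fun x hx => or_iff_not_imp_left.2 (hdich x hx))
      ⟨p₀, hp₀, O₀, ⟨hO₀, hpO₀, hP₀⟩, hpO₀⟩ ⟨q, hq, hdich q hq hqE⟩
    exact (hdis ▸ ⟨⟨hxM, hxO⟩, hxE⟩ : x ∈ (∅ : Set (EuclideanSpace ℝ (Fin N))))
  obtain ⟨O, hO, hpO, hMO, hP⟩ :
      ∃ O, IsOpen O ∧ p₀ ∈ O ∧ M ⊆ O ∧ IsPoincareSet M (M ∩ O) := by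
    -- Keeping `p₀` in every set guarantees that any two of them overlap on M and can be glued.
    refine hcompact.induction_on
      (p := fun s => ∃ O, IsOpen O ∧ p₀ ∈ O ∧ s ⊆ O ∧ IsPoincareSet M (M ∩ O)) ?_ ?_ ?_ ?_
    · obtain ⟨O, hO, hpO, hP⟩ := hM.exists_isPoincareSet hp₀
      exact ⟨O, hO, hpO, empty_subset _, hP⟩
    · rintro s t hst ⟨O, hO, hpO, hs, hP⟩
      exact ⟨O, hO, hpO, hst.trans hs, hP⟩
    · rintro s t ⟨O, hO, hpO, hs, hP⟩ ⟨O', hO', hpO', hs', hP'⟩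
      exact ⟨O ∪ O', hO.union hO', Or.inl hpO, union_subset_union hs hs',
        hunion O O' hO hO' hP hP' ⟨p₀, hp₀, hpO, hpO'⟩⟩
    · intro x hx
      obtain ⟨O, hO, hpO, hxO, hP⟩ := hjoin x hx
      exact ⟨O, mem_nhdsWithin_of_mem_nhds (hO.mem_nhds hxO), O, hO, hpO, Subset.rfl, hP⟩
  rwa [inter_eq_left.2 hMO] at hP

/-! ### From oscillation to deviation from the mean -/

/-- The mean deviation is bounded by the mean oscillation. -/
theorem lintegral_enorm_sub_mean_le {α : Type*} [MeasurableSpace α] {μ : Measure α}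
    [IsFiniteMeasure μ] (hμ : μ univ ≠ 0) {f : α → ℝ} (hf : Integrable f μ) :
    ∫⁻ x, ‖f x - (μ.real univ)⁻¹ * ∫ y, f y ∂μ‖ₑ ∂μ ≤ (μ univ)⁻¹ * meanOscillation μ f := by
  have hr : μ.real univ ≠ 0 := (ENNReal.toReal_pos hμ (measure_ne_top μ univ)).ne'
  rw [meanOscillation, ← lintegral_const_mul' _ _ (ENNReal.inv_ne_top.2 hμ)]
  refine lintegral_mono fun x => ?_
  -- The deviation from the mean is the mean of the differences.
  have h1 : f x - (μ.real univ)⁻¹ * ∫ y, f y ∂μ = (μ.real univ)⁻¹ * ∫ y, (f x - f y) ∂μ := by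
    rw [integral_sub (integrable_const _) hf, integral_const, smul_eq_mul]
    field_simp
  rw [h1, enorm_mul, enorm_inv hr, Measure.real, Real.enorm_of_nonneg ENNReal.toReal_nonneg,
    ENNReal.ofReal_toReal (measure_ne_top μ univ)]
  gcongr
  refine (enorm_integral_le_lintegral_enorm _).trans_eq ?_
  simp only [enorm_sub_rev (f x)]

theorem lemma7p1 (N : ℕ) (hN : 3 ≤ N) (M : Set (EuclideanSpace ℝ (Fin N)))
    (hM : IsSmoothHypersurface M) (hcompact : IsCompact M) (hconn : IsConnected M) :
    ∃ C : ℝ, 0 < C ∧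
      ∀ (u : EuclideanSpace ℝ (Fin N) → ℝ)
        (g : EuclideanSpace ℝ (Fin N) → EuclideanSpace ℝ (Fin N)),
        MemW11 M u g →
          eLpNorm (fun x => u x - ((surfaceMeasure M).real M)⁻¹ * ∫ y, u y ∂(surfaceMeasure M)) 1
              (surfaceMeasure M) ≤
            ENNReal.ofReal C * eLpNorm g 1 (surfaceMeasure M) := by
  obtain ⟨hfin, C, hC, hosc⟩ := hM.isPoincareSet hcompact hconn
  have hpos : Measure.euclideanHausdorffMeasure (N - 1) M ≠ 0 := by
    simpa using hM.measure_pos isOpen_univ (by simpa using hconn.nonempty)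
  have hfinite : IsFiniteMeasure (surfaceMeasure M) := isFiniteMeasure_restrict.2 hfin
  have huniv : surfaceMeasure M univ = Measure.euclideanHausdorffMeasure (N - 1) M := by
    simp [surfaceMeasure]
  have hself : surfaceMeasure M M = surfaceMeasure M univ := by
    rw [huniv, surfaceMeasure, Measure.restrict_apply_self]
  have hreal : (surfaceMeasure M).real M = (surfaceMeasure M).real univ := by
    simp only [Measure.real, hself]
  have hD : (surfaceMeasure M univ)⁻¹ * C ≠ ⊤ :=
    ENNReal.mul_ne_top (ENNReal.inv_ne_top.2 (huniv ▸ hpos)) hC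
  -- Adding 1 makes the constant positive even when `C = 0`.
  refine ⟨((surfaceMeasure M univ)⁻¹ * C).toReal + 1, by positivity, fun u g hu => ?_⟩
  rw [eLpNorm_one_eq_lintegral_enorm, eLpNorm_one_eq_lintegral_enorm, hreal]
  calc _ ≤ (surfaceMeasure M univ)⁻¹ * meanOscillation (surfaceMeasure M) u :=
        lintegral_enorm_sub_mean_le (huniv ▸ hpos) (memLp_one_iff_integrable.1 hu.memLp)
    _ ≤ (surfaceMeasure M univ)⁻¹ * (C * ∫⁻ x, ‖g x‖ₑ ∂surfaceMeasure M) := by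
        gcongr
        exact hosc u g hu
    _ = (surfaceMeasure M univ)⁻¹ * C * ∫⁻ x, ‖g x‖ₑ ∂surfaceMeasure M := by rw [mul_assoc]
    _ ≤ _ := by
        gcongr
        rw [ENNReal.le_ofReal_iff_toReal_le hD (by positivity)]
        linarith
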